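/- Let $\mathbb{X}$ be a topological space and $\mathbb{U}$ a compact topological space, each with its Borel $\sigma$-algebra, and let $T(\cdot\mid x,u)$ be a stochastic kernel on $\mathbb{X}$ given $\mathbb{X}\times\mathbb{U}$ (a probability measure on $\mathbb{X}$ for each $(x,u)$, measurable in $(x,u)$); write $\mathcal{S}=(\mathbb{X},\mathbb{U},T)$. For $N\in\mathbb{N}=\{0,1,2,\dots\}$, a Markov policy with horizon $N$ is a sequence $\boldsymbol{\mu}=(\mu_0,\dots,\mu_{N-1})$ of universally measurable maps $\mu_k:\mathbb{X}\to\mathbb{U}$, that is, the preimage under $\mu_k$ of every Borel set is measurable for the completion of every Borel probability measure on $\mathbb{X}$. For a Borel set $\mathbb{Q}\subseteq\mathbb{X}$ and $x\in\mathbb{X}$ let $$p^{\boldsymbol{\mu}}_{N,\mathbb{Q}}(x)=\Pr\{x_k\in\mathbb{Q}\text{ for all }0\le k\le N\},$$ where $(x_0,\dots,x_N)$ is the Markov process with $x_0=x$ and $x_{k+1}\sim T(\cdot\mid x_k,\mu_k(x_k))$ given $x_0,\dots,x_k$. For $0\le\epsilon\le1$, a Borel set $\mathbb{Q}$ is called an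 $N$-step $\epsilon$-probabilistic controlled invariant set ($N$-step $\epsilon$-PCIS) for $\mathcal{S}$ if for every $x\in\mathbb{Q}$ there is a Markov policy $\boldsymbol{\mu}$ with horizon $N$ such that $p^{\boldsymbol{\mu}}_{N,\mathbb{Q}}(x)\ge\epsilon$. **Property.** Let $r\ge1$ and, for $i=1,\dots,r$, let $N_i\in\mathbb{N}$, $\epsilon_i\in[0,1]$ and let $\mathbb{Q}_i\subseteq\mathbb{X}$ be a Borel set that is an $N_i$-step $\epsilon_i$-PCIS for $\mathcal{S}$. Then $\bigcup_{i=1}^r\mathbb{Q}_i$ is an $N$-step $\epsilon$-PCIS for $\mathcal{S}$, where $N=\min_i N_i$ and $\epsilon=\min_i\epsilon_i$. -/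

import Mathlib

open MeasureTheory ProbabilityTheory

/-- A subset of `Y` is universally measurable if it is measurable with respect to the completion
of every probability measure on (the Borel sets of) `Y`. -/
def UniversallyMeasurableSet {Y : Type*} [MeasurableSpace Y] (A : Set Y) : Prop :=
  ∀ p : Measure Y, IsProbabilityMeasure p → NullMeasurableSet A p

/-- A map is universally measurable if the preimages of (Borel) measurable sets are universally
measurable. -/
def UniversallyMeasurable {Y W : Type*} [MeasurableSpace Y] [MeasurableSpace W]
    (f : Y → W) : Prop :=
  ∀ A : Set W, MeasurableSet A → UniversallyMeasurableSet (f ⁻¹' A)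

/-- A Markov policy with horizon `N`: a sequence `(μ₀, …, μ_{N-1})` of universally measurable maps
from states to controls. -/
structure MarkovPolicy (X U : Type*) [MeasurableSpace X] [MeasurableSpace U] (N : ℕ) where
  toFun : Fin N → X → U
  universallyMeasurable : ∀ k, UniversallyMeasurable (toFun k)

/-- Given the law `P` of a history `h = (x₀, …, x_n)`, the law of the history `(x₀, …, x_{n+1})`
obtained when the control `m (x_n)` is applied: the next state is distributed according to
`T (· | x_n, m (x_n))` and is appended to `h`. As `m` is only universally measurable, the law `P` is
completed before the transition is averaged over it. -/
noncomputable def extendLaw {X U : Type*} [MeasurableSpace X] [MeasurableSpace U]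
    (T : Kernel (X × U) X) {n : ℕ} (P : Measure (Fin (n + 1) → X)) (m : X → U) :
    Measure (Fin (n + 2) → X) :=
  P.completion.bind (fun h : Fin (n + 1) → X =>
    (T (h (Fin.last n), m (h (Fin.last n)))).map (fun y => (Fin.snoc h y : Fin (n + 2) → X)))

/-- The law of the execution `(x₀, x₁, …, x_N)` of the controlled process with transition kernel
`T` started at `x₀`, when the control `μ_k (x_k)` is applied at each time `k < N`. -/
noncomputable def executionLaw {X U : Type*} [MeasurableSpace X] [MeasurableSpace U]
    (T : Kernel (X × U) X) (x₀ : X) :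
    (N : ℕ) → (Fin N → X → U) → Measure (Fin (N + 1) → X)
  | 0, _ => Measure.dirac (fun _ => x₀)
  | N + 1, μ => extendLaw T (executionLaw T x₀ N (fun k => μ k.castSucc)) (μ (Fin.last N))

/-- The probability `p_{N,Q}^μ(x₀)` that `x_k ∈ Q` for all `0 ≤ k ≤ N` under the policy `μ`. -/
noncomputable def invarianceProb {X U : Type*} [MeasurableSpace X] [MeasurableSpace U]
    (T : Kernel (X × U) X) (N : ℕ) (Q : Set X) (μ : MarkovPolicy X U N) (x₀ : X) : ℝ :=
  (executionLaw T x₀ N μ.toFun).real {h | ∀ k : Fin (N + 1), h k ∈ Q}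

/-- `Q` is an `N`-step `ε`-probabilistic controlled invariant set (PCIS) for the system with
transition kernel `T`. -/
structure IsPCIS {X U : Type*} [MeasurableSpace X] [MeasurableSpace U]
    (T : Kernel (X × U) X) (N : ℕ) (ε : ℝ) (Q : Set X) : Prop where
  level_nonneg : 0 ≤ ε
  level_le_one : ε ≤ 1
  measurableSet : MeasurableSet Q
  exists_policy : ∀ x ∈ Q, ∃ μ : MarkovPolicy X U N, ε ≤ invarianceProb T N Q μ x

/-! For `x ∈ Q i`, take a policy for `Q i` with horizon `N i` and forget its controls after time
`min N`. Staying in the union for the shorter time is at least as likely as staying in `Q i` for the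
full time, so the bound `ε i ≥ min ε` survives. The substance is that the past of an execution does
not depend on later controls: appending a state leaves the law of the history unchanged
(`extendLaw_init_preimage`). This needs the transition to be measurable for the completed law
(`measurable_extendLaw_kernel`), since `Measure.bind` is zero for a kernel that is not a.e.
measurable. -/

/-- The preimage of a universally measurable set under a measurable map is null measurable for
every probability measure. -/
lemma UniversallyMeasurableSet.nullMeasurableSet_preimage {Y Z : Type*} [MeasurableSpace Y]
    [MeasurableSpace Z] {A : Set Y} (hA : UniversallyMeasurableSet A) (P : Measure Z)
    [IsProbabilityMeasure P] {g : Z → Y} (hg : Measurable g) : NullMeasurableSet (g ⁻¹' A) P :=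
  (hA (P.map g) (Measure.isProbabilityMeasure_map hg.aemeasurable)).preimage
    ⟨hg, Measure.AbsolutelyContinuous.rfl⟩

lemma measurable_fin_snoc {X : Type*} [MeasurableSpace X] (n : ℕ) :
    Measurable (fun p : (Fin n → X) × X => (Fin.snoc p.1 p.2 : Fin (n + 1) → X)) := by
  refine measurable_pi_lambda _ fun k => ?_
  refine Fin.lastCases ?_ (fun j => ?_) k
  · simpa using measurable_snd
  · simpa using measurable_fst.eval (a := j)

/-- The transition kernel averaged over by `extendLaw` is measurable for the completed law of the
history. -/
lemma measurable_extendLaw_kernel {X U : Type*} [MeasurableSpace X] [MeasurableSpace U]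
    (T : Kernel (X × U) X) [IsMarkovKernel T] {n : ℕ} (P : Measure (Fin (n + 1) → X))
    [IsProbabilityMeasure P] {m : X → U} (hm : UniversallyMeasurable m) :
    Measurable (fun h : NullMeasurableSpace (Fin (n + 1) → X) P =>
      (T (h (Fin.last n), m (h (Fin.last n)))).map
        (fun y => (Fin.snoc h y : Fin (n + 2) → X))) := by
  -- The completed σ-algebra is finer, so `id` carries Borel measurability over to it.
  have hid : @Measurable (NullMeasurableSpace (Fin (n + 1) → X) P) (Fin (n + 1) → X)
      NullMeasurableSpace.instMeasurableSpace MeasurableSpace.pi id :=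
    fun s hs => MeasurableSet.nullMeasurableSet hs
  have hlast : Measurable (fun h : Fin (n + 1) → X => h (Fin.last n)) := measurable_pi_apply _
  have hctrl : Measurable
      (fun h : NullMeasurableSpace (Fin (n + 1) → X) P => m (h (Fin.last n))) :=
    fun s hs => (hm s hs).nullMeasurableSet_preimage P hlast
  have hpair := (hlast.comp hid).prodMk hctrl
  have hsnoc : Measurable (fun p : NullMeasurableSpace (Fin (n + 1) → X) P × X =>
      (Fin.snoc (α := fun _ => X) p.1 p.2 : Fin (n + 2) → X)) :=
    (measurable_fin_snoc (n + 1)).comp ((hid.comp measurable_fst).prodMk measurable_snd)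
  refine Measure.measurable_of_measurable_coe _ fun s hs => ?_
  -- The mass given to `s` is the kernel measure of a section of a jointly measurable set, hence
  -- measurable in `h`.
  have key := Kernel.measurable_kernel_prodMk_left (κ := T.comap _ hpair) (hsnoc hs)
  exact (funext fun h => Measure.map_apply (hsnoc.comp measurable_prodMk_left) hs) ▸ key

/-- The law of the extended history, evaluated on an event depending only on the past. -/
lemma extendLaw_init_preimage {X U : Type*} [MeasurableSpace X] [MeasurableSpace U]
    (T : Kernel (X × U) X) [IsMarkovKernel T] {n : ℕ} (P : Measure (Fin (n + 1) → X))
    [IsProbabilityMeasure P] {m : X → U} (hm : UniversallyMeasurable m)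
    {A : Set (Fin (n + 1) → X)} (hA : MeasurableSet A) :
    extendLaw T P m {h | (fun k : Fin (n + 1) => h k.castSucc) ∈ A} = P A := by
  have hinit : Measurable (fun (h : Fin (n + 2) → X) (k : Fin (n + 1)) => h k.castSucc) :=
    measurable_pi_lambda _ fun k => measurable_pi_apply _
  have hA' : MeasurableSet {h : Fin (n + 2) → X | (fun k : Fin (n + 1) => h k.castSucc) ∈ A} :=
    hinit hA
  -- The appended state does not affect the past, and `T` has total mass one.
  have hval : ∀ h : Fin (n + 1) → X,
      (T (h (Fin.last n), m (h (Fin.last n)))).map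
        (fun y => (Fin.snoc h y : Fin (n + 2) → X))
        {h | (fun k : Fin (n + 1) => h k.castSucc) ∈ A} = A.indicator 1 h := by
    intro h
    have hsnoc : Measurable (fun y => (Fin.snoc h y : Fin (n + 2) → X)) :=
      (measurable_fin_snoc (n + 1)).comp measurable_prodMk_left
    rw [Measure.map_apply hsnoc hA']
    by_cases hh : h ∈ A <;> simp [hh]
  have hA0 : MeasurableSet (α := NullMeasurableSpace (Fin (n + 1) → X) P) A :=
    hA.nullMeasurableSet
  refine (Measure.bind_apply hA' (measurable_extendLaw_kernel T P hm).aemeasurable).trans ?_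
  refine (lintegral_congr hval).trans ((lintegral_indicator_one hA0).trans ?_)
  exact Measure.completion_apply P A

lemma isProbabilityMeasure_executionLaw {X U : Type*} [MeasurableSpace X] [MeasurableSpace U]
    (T : Kernel (X × U) X) [IsMarkovKernel T] (x₀ : X) :
    ∀ (N : ℕ) (μ : Fin N → X → U), (∀ k, UniversallyMeasurable (μ k)) →
      IsProbabilityMeasure (executionLaw T x₀ N μ)
  | 0, _, _ => by
    rw [executionLaw]
    infer_instance
  | N + 1, μ, hμ => by
    have := isProbabilityMeasure_executionLaw T x₀ N (fun k => μ k.castSucc) fun k => hμ _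
    refine ⟨?_⟩
    -- The sure event shows that the total mass is preserved.
    simpa [executionLaw] using extendLaw_init_preimage T
      (executionLaw T x₀ N fun k => μ k.castSucc) (hμ (Fin.last N)) MeasurableSet.univ

/-- Staying in `Q` up to time `M` is at most as likely as staying in `Q` up to an earlier time
`N` under the truncated policy. -/
lemma executionLaw_stay_le_of_le {X U : Type*} [MeasurableSpace X] [MeasurableSpace U]
    (T : Kernel (X × U) X) [IsMarkovKernel T] (x₀ : X) {Q : Set X} (hQ : MeasurableSet Q)
    {N M : ℕ} (hNM : N ≤ M) (μ : Fin M → X → U) (hμ : ∀ k, UniversallyMeasurable (μ k)) :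
    executionLaw T x₀ M μ {h | ∀ k, h k ∈ Q} ≤
      executionLaw T x₀ N (fun k => μ (k.castLE hNM)) {h | ∀ k, h k ∈ Q} := by
  induction M, hNM using Nat.le_induction with
  | base => exact le_rfl
  | succ M hNM ih =>
    have := isProbabilityMeasure_executionLaw T x₀ M (fun k => μ k.castSucc) fun k => hμ _
    have hstay : MeasurableSet {h : Fin (M + 1) → X | ∀ k, h k ∈ Q} := by
      rw [Set.ofPred_forall]
      exact MeasurableSet.iInter fun k => measurable_pi_apply k hQ
    calc executionLaw T x₀ (M + 1) μ {h | ∀ k, h k ∈ Q}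
        ≤ executionLaw T x₀ (M + 1) μ
            {h | (fun k : Fin (M + 1) => h k.castSucc) ∈ {h | ∀ k, h k ∈ Q}} :=
          -- Only the constraint on the last state is dropped.
          measure_mono fun h hh k => hh k.castSucc
      _ = executionLaw T x₀ M (fun k => μ k.castSucc) {h | ∀ k, h k ∈ Q} :=
          extendLaw_init_preimage T _ (hμ (Fin.last M)) hstay
      _ ≤ _ := ih (fun k => μ k.castSucc) fun k => hμ _

/-- The truncation of a Markov policy to a shorter horizon. -/
def MarkovPolicy.truncate {X U : Type*} [MeasurableSpace X] [MeasurableSpace U] {N M : ℕ}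
    (μ : MarkovPolicy X U M) (hNM : N ≤ M) : MarkovPolicy X U N where
  toFun k := μ.toFun (k.castLE hNM)
  universallyMeasurable _ := μ.universallyMeasurable _

lemma invarianceProb_le_truncate {X U : Type*} [MeasurableSpace X] [MeasurableSpace U]
    (T : Kernel (X × U) X) [IsMarkovKernel T] {N M : ℕ} (hNM : N ≤ M) {Q Q' : Set X}
    (hQ : MeasurableSet Q) (hQQ' : Q ⊆ Q') (μ : MarkovPolicy X U M) (x₀ : X) :
    invarianceProb T M Q μ x₀ ≤ invarianceProb T N Q' (μ.truncate hNM) x₀ := by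
  have := isProbabilityMeasure_executionLaw T x₀ N (μ.truncate hNM).toFun
    (μ.truncate hNM).universallyMeasurable
  -- `toReal` sends `∞` to `0`, so monotonicity needs the larger side to be finite.
  refine ENNReal.toReal_mono (measure_ne_top _ _) ?_
  exact (executionLaw_stay_le_of_le T x₀ hQ hNM μ.toFun μ.universallyMeasurable).trans
    (measure_mono fun h hh k => hQQ' (hh k))

theorem mainTheorem9
    {X U : Type*} [TopologicalSpace X] [MeasurableSpace X] [BorelSpace X]
    [TopologicalSpace U] [CompactSpace U] [MeasurableSpace U] [BorelSpace U]
    (T : Kernel (X × U) X) [IsMarkovKernel T]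
    (r : ℕ) [NeZero r] (Q : Fin r → Set X) (N : Fin r → ℕ) (ε : Fin r → ℝ)
    (hQ : ∀ i, IsPCIS T (N i) (ε i) (Q i)) :
    IsPCIS T (Finset.univ.inf' Finset.univ_nonempty N)
      (Finset.univ.inf' Finset.univ_nonempty ε) (⋃ i, Q i) := by
  refine ⟨?_, ?_, MeasurableSet.iUnion fun i => (hQ i).measurableSet, fun x hx => ?_⟩
  · exact (Finset.le_inf'_iff _ _).2 fun i _ => (hQ i).level_nonneg
  · exact (Finset.inf'_le ε (Finset.mem_univ 0)).trans (hQ 0).level_le_one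
  · obtain ⟨i, hi⟩ := Set.mem_iUnion.1 hx
    obtain ⟨μ, hμ⟩ := (hQ i).exists_policy x hi
    have hN : Finset.univ.inf' Finset.univ_nonempty N ≤ N i := Finset.inf'_le N (Finset.mem_univ i)
    exact ⟨μ.truncate hN, (Finset.inf'_le ε (Finset.mem_univ i)).trans <| hμ.trans <|
      invarianceProb_le_truncate T hN (hQ i).measurableSet (Set.subset_iUnion Q i) μ x⟩
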